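/- For graphs $F$ and $H$, let $\mathrm{ex}(n,F,H)$ denote the maximum number of copies of $F$ (subgraphs isomorphic to $F$) in a graph on $n$ vertices that contains no subgraph isomorphic to $H$. Let $K_r$ be the complete graph on $r$ vertices and $K_{s_1,\ldots,s_r}$ the complete $r$-partite graph with parts of sizes $s_1,\ldots,s_r$. Then for every integer $r \ge 3$ and all fixed positive integers $s_1 \le s_2 \le \cdots \le s_r$, $$\mathrm{ex}(n, K_r, K_{s_1,\ldots,s_r}) = o\left(n^{\,r - 1/\prod_{i=1}^{r-1} s_i}\right) \quad \text{as } n \to \infty.$$ -/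

import Mathlib

open scoped Asymptotics

open Classical in
/-- The generalized Turán number `ex(n, F, H)`: the maximum number of (unlabelled, not necessarily
induced) copies of `F` in an `H`-free graph on `n` vertices, where `H`-free means that no subgraph
is isomorphic to `H`. -/
noncomputable def generalizedTuranNumber (n : ℕ) {V W : Type*}
    (F : SimpleGraph V) (H : SimpleGraph W) : ℕ :=
  (Finset.univ.filter fun G : SimpleGraph (Fin n) => H.Free G).sup fun G => G.copyCount F

/-! ### Double counting and convexity. -/

section CliqueCounting

open Finset
open scoped Classical Nat

/-! Put `x = n ^ (-1 / P)`, with `P` the product of all part sizes but the last; this is encoded as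
`x ^ P * n = 1`, which keeps the counting free of real exponents. For `r = 3`, fix an `a`-set `S`.
Between its common neighbourhoods `G` has no `K_{b,c+1}`, so Kővári–Sós–Turán bounds the edges
there, and convexity over `S` gives `O(n ^ 3 * x)` triangles. This is `o(n ^ 3)`, so triangle
removal supplies a subgraph `H` with at most `η * n ^ 2` edges (up to a constant) meeting every
triangle. Repeating the count with one edge forced into `H` (`card_triangles_through_subgraph_le`)
makes the constant arbitrarily small. For larger `r`, the common link of an `s 0`-set avoids the
remaining multipartite graph, so induction bounds its cliques and the same convexity argument
(`card_cliqueFinset_succ_le`) lifts the bound by one vertex. -/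

/-- Double counting of the `k`-subsets of `X` all of whose members are related to `e ∈ E`. -/
theorem sum_choose_card_filter_eq {α β : Type*} (E : Finset α) (X : Finset β) (R : β → α → Prop)
    [∀ x e, Decidable (R x e)] (k : ℕ) :
    ∑ e ∈ E, (#{x ∈ X | R x e}).choose k
      = ∑ S ∈ X.powersetCard k, #{e ∈ E | ∀ x ∈ S, R x e} := by
  refine Eq.trans ?_ (Finset.sum_card_bipartiteAbove_eq_sum_card_bipartiteBelow
    (s := E) (t := X.powersetCard k) (fun (e : α) (S : Finset β) => ∀ x ∈ S, R x e))
  refine Finset.sum_congr rfl fun e _ => ?_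
  rw [← Finset.card_powersetCard]
  congr 1
  ext S
  simp only [Finset.mem_powersetCard, Finset.mem_bipartiteAbove, Finset.subset_iff,
    Finset.mem_filter]
  grind

/-- A bound on the number of `R`-related pairs in `X × E` from bounds on the number of common
relatives of the `k`-subsets of `X`. -/
theorem sum_card_filter_le_of_card_common_le {α β : Type*} (E : Finset α) (X : Finset β)
    (R : β → α → Prop) [∀ x e, Decidable (R x e)] {k : ℕ} (hk : 0 < k) {M τ : ℝ}
    (hM : (#E : ℝ) ≤ M) (hτ : 0 ≤ τ)
    (B : Finset β → ℝ)
    (hB : ∀ S ∈ X.powersetCard k, (#{e ∈ E | ∀ x ∈ S, R x e} : ℝ) ≤ B S)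
    (hbound : M ^ (k - 1) * (k ! * ∑ S ∈ X.powersetCard k, B S) ≤ τ ^ k) :
    (∑ e ∈ E, #{x ∈ X | R x e} : ℝ) ≤ (k - 1) * M + τ := by
  set d : α → ℕ := fun e => #{x ∈ X | R x e} with hd
  have hk1 : (1 : ℝ) ≤ k := by exact_mod_cast hk
  have hcount : (∑ e ∈ E, ((d e).choose k : ℝ)) ≤ ∑ S ∈ X.powersetCard k, B S := by
    have h1 := sum_choose_card_filter_eq E X R k
    have h2 : (∑ e ∈ E, ((d e).choose k : ℝ))
        = ∑ S ∈ X.powersetCard k, (#{e ∈ E | ∀ x ∈ S, R x e} : ℝ) := by exact_mod_cast h1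
    rw [h2]
    exact Finset.sum_le_sum hB
  -- Truncated subtraction makes `(d + 1 - k) ^ k ≤ k ! * d.choose k` valid for every `d`; undoing
  -- the shift costs at most `k - 1` per element of `E`.
  have hpow : (∑ e ∈ E, ((d e + 1 - k : ℕ) : ℝ)) ^ k ≤ τ ^ k := by
    obtain ⟨l, rfl⟩ : ∃ l, k = l + 1 := ⟨k - 1, by omega⟩
    have hch : ∑ e ∈ E, ((d e + 1 - (l + 1) : ℕ) : ℝ) ^ (l + 1)
        ≤ (l + 1)! * ∑ e ∈ E, ((d e).choose (l + 1) : ℝ) := by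
      rw [Finset.mul_sum]
      refine Finset.sum_le_sum fun e _ => ?_
      have := Nat.pow_sub_le_descFactorial (d e) (l + 1)
      rw [Nat.descFactorial_eq_factorial_mul_choose] at this
      exact_mod_cast this
    calc (∑ e ∈ E, ((d e + 1 - (l + 1) : ℕ) : ℝ)) ^ (l + 1)
        ≤ (#E : ℝ) ^ l * ∑ e ∈ E, ((d e + 1 - (l + 1) : ℕ) : ℝ) ^ (l + 1) :=
          pow_sum_le_card_mul_sum_pow (fun _ _ => by positivity) l
      _ ≤ (#E : ℝ) ^ l * ((l + 1)! * ∑ e ∈ E, ((d e).choose (l + 1) : ℝ)) := by gcongr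
      _ ≤ M ^ l * ((l + 1)! * ∑ e ∈ E, ((d e).choose (l + 1) : ℝ)) := by gcongr
      _ ≤ M ^ l * ((l + 1)! * ∑ S ∈ X.powersetCard (l + 1), B S) := by
          have : 0 ≤ M := le_trans (by positivity) hM
          gcongr
      _ ≤ τ ^ (l + 1) := by simpa using hbound
  have hsum : ∑ e ∈ E, ((d e + 1 - k : ℕ) : ℝ) ≤ τ := le_of_pow_le_pow_left₀ hk.ne' hτ hpow
  calc (∑ e ∈ E, (d e : ℝ)) ≤ ∑ e ∈ E, ((k - 1 : ℝ) + ((d e + 1 - k : ℕ) : ℝ)) := by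
        refine Finset.sum_le_sum fun e _ => ?_
        have : d e + 1 ≤ k + (d e + 1 - k) := by omega
        have : (d e : ℝ) + 1 ≤ k + ((d e + 1 - k : ℕ) : ℝ) := by exact_mod_cast this
        linarith
    _ = (k - 1) * #E + ∑ e ∈ E, ((d e + 1 - k : ℕ) : ℝ) := by
        rw [Finset.sum_add_distrib, Finset.sum_const, nsmul_eq_mul]; ring
    _ ≤ (k - 1) * M + τ := by
        have : (0 : ℝ) ≤ k - 1 := by linarith
        gcongr

theorem factorial_mul_choose_le_pow (n k : ℕ) : (k ! : ℝ) * n.choose k ≤ (n : ℝ) ^ k := by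
  have := Nat.descFactorial_le_pow n k
  rw [Nat.descFactorial_eq_factorial_mul_choose] at this
  exact_mod_cast this

variable {V : Type*} [Fintype V]

/-- The Kővári–Sós–Turán bound for edges between `A` and `Z`. -/
theorem sum_card_adj_le_of_common_neighbors_le (G : SimpleGraph V) (A Z : Finset V) {b c : ℕ}
    (hb : 0 < b) (hc : 0 < c)
    (hfree : ∀ T ⊆ A, #T = b → #{z ∈ Z | ∀ y ∈ T, G.Adj y z} ≤ c) {y : ℝ} (hy : 0 ≤ y)
    (hyn : y ^ b * Fintype.card V = 1) :
    (∑ z ∈ Z, #{y ∈ A | G.Adj y z} : ℝ)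
      ≤ (b - 1) * Fintype.card V + c * Fintype.card V * y * #A := by
  set n : ℝ := (Fintype.card V : ℝ) with hn
  refine sum_card_filter_le_of_card_common_le Z A G.Adj hb (M := n) ?_ (by positivity)
    (fun _ => (c : ℝ)) ?_ ?_
  · exact Nat.cast_le.2 (Finset.card_le_univ Z)
  · intro S hS
    rw [Finset.mem_powersetCard] at hS
    refine Nat.cast_le.2 ?_
    convert hfree S hS.1 hS.2
  · rw [Finset.sum_const, Finset.card_powersetCard, nsmul_eq_mul]
    obtain ⟨l, rfl⟩ : ∃ l, b = l + 1 := ⟨b - 1, by omega⟩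
    have hc1 : (1 : ℝ) ≤ c := by exact_mod_cast hc
    have h1 := factorial_mul_choose_le_pow #A (l + 1)
    have hn0 : 0 ≤ n := by positivity
    calc n ^ (l + 1 - 1) * ((l + 1)! * (((#A).choose (l + 1) : ℝ) * c))
        = n ^ l * (((l + 1)! * (#A).choose (l + 1)) * c) := by rw [Nat.add_sub_cancel]; ring
      _ ≤ n ^ l * ((#A : ℝ) ^ (l + 1) * c ^ (l + 1)) := by
          gcongr
          exact le_self_pow₀ hc1 (by omega)
      _ = (c * n * y * #A) ^ (l + 1) := by
          linear_combination (-(n ^ l * ((#A : ℝ) ^ (l + 1) * c ^ (l + 1)))) * hyn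

/-- In a `K_{a,b,c}`-free graph `G` with a subgraph `H`, a bound on the number of triples `(x, y, z)`
spanning a triangle of `G` such that `xy` is an edge of `H`. -/
theorem card_triangles_through_subgraph_le (G H : SimpleGraph V) (hHG : H ≤ G) {a b c : ℕ}
    (ha : 0 < a) (hb : 0 < b) (hc : 0 < c)
    (hfree : ∀ S T Q : Finset V, #S = a → #T = b → (∀ x ∈ S, ∀ y ∈ T, G.Adj x y) →
      (∀ x ∈ S, ∀ z ∈ Q, G.Adj x z) → (∀ y ∈ T, ∀ z ∈ Q, G.Adj y z) → #Q ≤ c)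
    {x η t : ℝ} (hx : 0 ≤ x) (hxn : x ^ (a * b) * Fintype.card V = 1) (ht : 0 ≤ t)
    (hη : (∑ y, #{x | H.Adj x y} : ℝ) ≤ η * (Fintype.card V : ℝ) ^ 2)
    (hbound : a ! * ((b - 1) * x ^ (a * (b - 1)) + c * η) ≤ t ^ a) :
    (∑ p ∈ (univ : Finset (V × V)) with G.Adj p.1 p.2, #{x | H.Adj x p.1 ∧ G.Adj x p.2} : ℝ)
      ≤ (a - 1) * (Fintype.card V : ℝ) ^ 2 + t * (Fintype.card V : ℝ) ^ 3 * x := by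
  set n : ℝ := (Fintype.card V : ℝ) with hn
  have hn0 : 0 ≤ n := by positivity
  have hb1 : (0 : ℝ) ≤ b - 1 := by
    have : (1 : ℝ) ≤ b := by exact_mod_cast hb
    linarith
  refine sum_card_filter_le_of_card_common_le _ univ (fun x (p : V × V) => H.Adj x p.1 ∧ G.Adj x p.2)
    ha (M := n ^ 2) (τ := t * n ^ 3 * x) ?_ (by positivity)
    -- Kővári–Sós–Turán with `y = x ^ a`, since `(x ^ a) ^ b * n = 1`.
    (fun S => (b - 1) * n + c * n * x ^ a * #{y | ∀ x ∈ S, H.Adj x y}) ?_ ?_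
  · have : #{p : V × V | G.Adj p.1 p.2} ≤ Fintype.card V ^ 2 := by
      refine (Finset.card_le_univ _).trans ?_
      rw [Fintype.card_prod, sq]
    rw [hn]
    exact_mod_cast this
  · intro S hS
    rw [Finset.mem_powersetCard] at hS
    have h1 := sum_card_adj_le_of_common_neighbors_le G ({y | ∀ x ∈ S, H.Adj x y} : Finset V)
      ({z | ∀ x ∈ S, G.Adj x z} : Finset V) hb hc ?_ (y := x ^ a) (by positivity)
      (by rw [← pow_mul]; exact hxn)
    · refine le_trans (le_of_eq ?_) h1
      have h2 : #{e ∈ ({p : V × V | G.Adj p.1 p.2} : Finset (V × V)) |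
            ∀ x ∈ S, H.Adj x e.1 ∧ G.Adj x e.2}
          = ∑ z ∈ ({z | ∀ x ∈ S, G.Adj x z} : Finset V),
              #{y ∈ ({y | ∀ x ∈ S, H.Adj x y} : Finset V) | G.Adj y z} := by
        rw [Finset.card_eq_sum_card_fiberwise (f := Prod.snd)
          (t := ({z | ∀ x ∈ S, G.Adj x z} : Finset V))]
        · refine Finset.sum_congr rfl fun z hz => ?_
          refine Finset.card_bij' (fun p _ => p.1) (fun y _ => (y, z)) ?_ ?_ ?_ ?_
          all_goals simp only [Finset.mem_filter, Finset.mem_univ, true_and] at hz ⊢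
          all_goals grind
        · intro p hp
          simp only [Finset.coe_filter, Finset.mem_filter, Finset.mem_univ, true_and,
            Set.mem_ofPred_eq] at hp ⊢
          exact fun x hx => (hp.2 x hx).2
      have h3 := congrArg (Nat.cast (R := ℝ)) h2
      push_cast at h3
      convert h3
    · intro T hT hTb
      refine hfree S T _ hS.2 hTb ?_ ?_ ?_
      · intro x hx y hy
        have := hT hy
        simp only [Finset.mem_filter, Finset.mem_univ, true_and] at this
        exact hHG (this x hx)
      · intro x hx z hz
        simp only [Finset.mem_filter, Finset.mem_univ, true_and] at hz
        exact hz.1 x hx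
      · intro y hy z hz
        simp only [Finset.mem_filter, Finset.mem_univ, true_and] at hz
        exact hz.2 y hy
  · obtain ⟨l, rfl⟩ : ∃ l, a = l + 1 := ⟨a - 1, by omega⟩
    obtain ⟨m, rfl⟩ : ∃ m, b = m + 1 := ⟨b - 1, by omega⟩
    -- The sparsity of `H` enters here: `d.choose (l + 1) ≤ n ^ l * d` keeps one factor of the
    -- `H`-degree, so the sum is linear in `η`.
    have hα : (∑ S ∈ (univ : Finset V).powersetCard (l + 1), (#{y | ∀ x ∈ S, H.Adj x y} : ℝ))
        ≤ n ^ l * (η * n ^ 2) := by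
      have h1 : ∑ S ∈ (univ : Finset V).powersetCard (l + 1), #{y | ∀ x ∈ S, H.Adj x y}
          = ∑ y, (#{x | H.Adj x y}).choose (l + 1) := by
        convert (sum_choose_card_filter_eq univ univ H.Adj (l + 1)).symm
      have h2 : ∑ y, (#{x | H.Adj x y}).choose (l + 1)
          ≤ ∑ y, Fintype.card V ^ l * #{x | H.Adj x y} := by
        refine Finset.sum_le_sum fun y _ => ?_
        refine (Nat.choose_le_pow _ _).trans ?_
        rw [pow_succ]
        gcongr
        exact Finset.card_le_univ _
      rw [← Finset.mul_sum] at h2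
      have h3 : (∑ S ∈ (univ : Finset V).powersetCard (l + 1), (#{y | ∀ x ∈ S, H.Adj x y} : ℝ))
          ≤ n ^ l * ∑ y, (#{x | H.Adj x y} : ℝ) := by
        rw [← h1] at h2
        rw [hn]
        exact_mod_cast h2
      exact h3.trans (mul_le_mul_of_nonneg_left hη (by positivity))
    have hch : (((univ : Finset V).powersetCard (l + 1)).card : ℝ) ≤ n ^ (l + 1) := by
      rw [Finset.card_powersetCard, Finset.card_univ]
      rw [hn]
      exact_mod_cast Nat.choose_le_pow _ _
    have hS : ∑ S ∈ (univ : Finset V).powersetCard (l + 1),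
          (((m + 1 : ℕ) - 1 : ℝ) * n + c * n * x ^ (l + 1) * #{y | ∀ x ∈ S, H.Adj x y})
        ≤ n ^ (l + 1) * (m * n) + c * n * x ^ (l + 1) * (n ^ l * (η * n ^ 2)) := by
      rw [Finset.sum_add_distrib, Finset.sum_const, nsmul_eq_mul, ← Finset.mul_sum]
      push_cast
      rw [add_sub_cancel_right]
      gcongr
    push_cast at hbound
    simp only [add_sub_cancel_right] at hbound
    calc (n ^ 2) ^ (l + 1 - 1) * ((l + 1)! * ∑ S ∈ (univ : Finset V).powersetCard (l + 1),
            (((m + 1 : ℕ) - 1 : ℝ) * n + c * n * x ^ (l + 1) * #{y | ∀ x ∈ S, H.Adj x y}))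
        ≤ (n ^ 2) ^ (l + 1 - 1) * ((l + 1)! *
            (n ^ (l + 1) * (m * n) + c * n * x ^ (l + 1) * (n ^ l * (η * n ^ 2)))) := by gcongr
      _ = ((l + 1)! * (m * x ^ ((l + 1) * m) + c * η)) * (n ^ 3 * x) ^ (l + 1) := by
          have e : x ^ ((l + 1) * (m + 1)) = x ^ ((l + 1) * m) * x ^ (l + 1) := by ring
          rw [e] at hxn
          rw [Nat.add_sub_cancel]
          linear_combination (-((l + 1)! * m * n ^ (3 * l + 2))) * hxn
      _ ≤ t ^ (l + 1) * (n ^ 3 * x) ^ (l + 1) := by gcongr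
      _ = (t * n ^ 3 * x) ^ (l + 1) := by ring

end CliqueCounting

/-! ### Triangles: the big-O bound and its improvement by triangle removal. -/

section TriangleCounting

open Finset
open scoped Classical Nat

variable {V : Type*} [Fintype V]

/-- If every triangle of `G` has an edge in `H`, then the number of triangles of `G` is at most the
number of triples `(x, y, z)` spanning a triangle of `G` with `xy` an edge of `H`. -/
theorem card_cliqueFinset_three_le (G H : SimpleGraph V)
    (hcover : ∀ u v w, G.Adj u v → G.Adj u w → G.Adj v w →
      H.Adj u v ∨ H.Adj u w ∨ H.Adj v w) :
    #(G.cliqueFinset 3)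
      ≤ ∑ p ∈ (univ : Finset (V × V)) with G.Adj p.1 p.2, #{x | H.Adj x p.1 ∧ G.Adj x p.2} := by
  rw [← Finset.card_sigma]
  refine (Finset.card_le_card ?_).trans
    (Finset.card_image_le (f := fun q : Σ _ : V × V, V => ({q.2, q.1.1, q.1.2} : Finset V)))
  intro t ht
  rw [SimpleGraph.mem_cliqueFinset_iff, SimpleGraph.is3Clique_iff] at ht
  obtain ⟨u, v, w, huv, huw, hvw, rfl⟩ := ht
  simp only [Finset.mem_image, Finset.mem_sigma, Finset.mem_filter, Finset.mem_univ, true_and]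
  rcases hcover u v w huv huw hvw with h | h | h
  · exact ⟨⟨(v, w), u⟩, ⟨hvw, h, huw⟩, rfl⟩
  · exact ⟨⟨(w, v), u⟩, ⟨hvw.symm, h, huv⟩, by ext; simp; tauto⟩
  · exact ⟨⟨(w, u), v⟩, ⟨huw.symm, h, huv.symm⟩, by ext; simp; tauto⟩

theorem sum_card_adj_eq_two_mul_card_edgeFinset (H : SimpleGraph V) :
    ∑ y, #{x | H.Adj x y} = 2 * #H.edgeFinset := by
  rw [← H.sum_degrees_eq_twice_card_edges]
  refine Finset.sum_congr rfl fun y _ => ?_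
  rw [← H.card_neighborFinset_eq_degree]
  congr 1
  ext x
  simp [H.adj_comm]

/-- The triangles of a `K_{a,b,c}`-free graph number `O(n ^ (3 - 1 / (a * b)))`. -/
theorem card_triangles_le_of_free (G : SimpleGraph V) {a b c : ℕ}
    (ha : 0 < a) (hb : 0 < b) (hc : 0 < c)
    (hfree : ∀ S T Q : Finset V, #S = a → #T = b → (∀ x ∈ S, ∀ y ∈ T, G.Adj x y) →
      (∀ x ∈ S, ∀ z ∈ Q, G.Adj x z) → (∀ y ∈ T, ∀ z ∈ Q, G.Adj y z) → #Q ≤ c)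
    {x : ℝ} (hx : 0 ≤ x) (hx1 : x ≤ 1) (hxn : x ^ (a * b) * Fintype.card V = 1) :
    (#(G.cliqueFinset 3) : ℝ) ≤ (a + a ! * (b + c)) * (Fintype.card V : ℝ) ^ 3 * x := by
  have h1 : (#(G.cliqueFinset 3) : ℝ) ≤ _ :=
    Nat.cast_le.2 (card_cliqueFinset_three_le G G fun _ _ _ h _ _ => Or.inl h)
  have h2 := card_triangles_through_subgraph_le G G le_rfl ha hb hc hfree (η := 1)
    (t := a ! * (b + c)) hx hxn (by positivity) ?_ ?_
  · push_cast at h1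
    refine (h1.trans h2).trans ?_
    have h3 : ((a : ℝ) - 1) * (Fintype.card V : ℝ) ^ 2 ≤ a * (Fintype.card V : ℝ) ^ 3 * x := by
      have h4 : x ^ (a * b) ≤ x := pow_le_of_le_one hx hx1 (by positivity)
      calc ((a : ℝ) - 1) * (Fintype.card V : ℝ) ^ 2 ≤ a * (Fintype.card V : ℝ) ^ 2 := by
            gcongr; linarith
        _ = a * (Fintype.card V : ℝ) ^ 3 * x ^ (a * b) := by
            linear_combination (-(a * (Fintype.card V : ℝ) ^ 2)) * hxn
        _ ≤ _ := by gcongr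
    linarith
  · have h : ∑ y, #{x | G.Adj x y} ≤ Fintype.card V ^ 2 := by
      rw [sq, ← smul_eq_mul, ← Finset.card_univ, ← Finset.sum_const]
      exact Finset.sum_le_sum fun _ _ => Finset.card_le_univ _
    rw [one_mul]
    exact_mod_cast h
  · have hb1 : (1 : ℝ) ≤ b := by exact_mod_cast hb
    have hc1 : (1 : ℝ) ≤ c := by exact_mod_cast hc
    have hf : (1 : ℝ) ≤ a ! := by exact_mod_cast Nat.factorial_pos a
    have hp : x ^ (a * (b - 1)) ≤ 1 := pow_le_one₀ hx hx1
    calc (a ! : ℝ) * ((b - 1) * x ^ (a * (b - 1)) + c * 1)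
        ≤ a ! * (b * 1 + c * 1) := by gcongr; linarith
      _ = a ! * (b + c) := by ring
      _ ≤ (a ! * (b + c)) ^ a := le_self_pow₀ (by nlinarith) ha.ne'

/-- The triangles of a `K_{a,b,c}`-free graph number `o(n ^ (3 - 1 / (a * b)))`. -/
theorem exists_card_triangles_le_of_free {a b c : ℕ} (ha : 0 < a) (hb : 0 < b) (hc : 0 < c)
    {ε : ℝ} (hε : 0 < ε) :
    ∃ δ > 0, ∀ (V : Type) [Fintype V] (G : SimpleGraph V) (x : ℝ), 0 < x → x < δ →
      x ^ (a * b) * Fintype.card V = 1 →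
      (∀ S T Q : Finset V, #S = a → #T = b → (∀ x ∈ S, ∀ y ∈ T, G.Adj x y) →
        (∀ x ∈ S, ∀ z ∈ Q, G.Adj x z) → (∀ y ∈ T, ∀ z ∈ Q, G.Adj y z) → #Q ≤ c) →
      (#(G.cliqueFinset 3) : ℝ) ≤ ε * (Fintype.card V : ℝ) ^ 3 * x := by
  -- With `η = κ / c`, this gives `a ! * (κ + c * η) = (ε / 2) ^ a`.
  set κ : ℝ := (ε / 2) ^ a / (2 * a !) with hκ
  have hκ0 : 0 < κ := by positivity
  have hbpos : (0 : ℝ) < b := by exact_mod_cast hb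
  have hapos : (0 : ℝ) < a := by exact_mod_cast ha
  have hcpos : (0 : ℝ) < c := by exact_mod_cast hc
  set η : ℝ := κ / c with hη
  have hη0 : 0 < η := by positivity
  -- Half of `η`, because the degree sum of `H` counts each removed edge twice.
  set ρ : ℝ := SimpleGraph.triangleRemovalBound (η / 2) with hρ
  have hρ0 : 0 < ρ := SimpleGraph.triangleRemovalBound_pos (by positivity)
  set C : ℝ := a + a ! * (b + c) with hC
  have hC0 : 0 < C := by positivity
  -- `ρ / C` puts the big-O bound below the removal threshold; `κ / b` and `ε / 2 / a` absorb the
  -- lower-order terms.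
  refine ⟨min (min 1 (ρ / C)) (min (κ / b) (ε / 2 / a)), by positivity, ?_⟩
  intro V _ G x hx0 hxδ hxn hfree
  simp only [lt_min_iff] at hxδ
  obtain ⟨⟨hx1, hxρ⟩, hxκ, hxε⟩ := hxδ
  rw [lt_div_iff₀ hC0] at hxρ
  rw [lt_div_iff₀ hbpos] at hxκ
  rw [lt_div_iff₀ hapos] at hxε
  have hn0 : (0 : ℝ) < Fintype.card V := by
    by_contra h
    have : (Fintype.card V : ℝ) = 0 := le_antisymm (not_lt.1 h) (by positivity)
    simp [this] at hxn
  have hfew : (#(G.cliqueFinset 3) : ℝ) < ρ * (Fintype.card V : ℝ) ^ 3 := by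
    refine (card_triangles_le_of_free G ha hb hc hfree hx0.le hx1.le hxn).trans_lt ?_
    calc C * (Fintype.card V : ℝ) ^ 3 * x = (x * C) * (Fintype.card V : ℝ) ^ 3 := by ring
      _ < _ := by gcongr
  obtain ⟨G', hG'G, hdec, hedges, hG'⟩ := SimpleGraph.triangle_removal hfew
  obtain ⟨H, hH⟩ : ∃ H : SimpleGraph V, H = G \ G' := ⟨_, rfl⟩
  have hHedges : (#H.edgeFinset : ℝ) = #G.edgeFinset - #G'.edgeFinset := by
    have h1 : H.edgeFinset = G.edgeFinset \ G'.edgeFinset := by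
      ext e; simp [hH]
    rw [h1, Finset.card_sdiff_of_subset (SimpleGraph.edgeFinset_mono hG'G),
      Nat.cast_sub (Finset.card_le_card (SimpleGraph.edgeFinset_mono hG'G))]
  have hdeg : (∑ y, #{x | H.Adj x y} : ℝ) ≤ η * (Fintype.card V : ℝ) ^ 2 := by
    have h1 : (∑ y, #{x | H.Adj x y} : ℝ) = 2 * #H.edgeFinset := by
      exact_mod_cast sum_card_adj_eq_two_mul_card_edgeFinset H
    rw [h1, hHedges]
    push_cast at hedges
    linarith
  have hcover : ∀ u v w, G.Adj u v → G.Adj u w → G.Adj v w →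
      H.Adj u v ∨ H.Adj u w ∨ H.Adj v w := by
    intro u v w huv huw hvw
    by_contra! h
    simp only [hH, SimpleGraph.sdiff_adj, huv, huw, hvw, true_and, not_not] at h
    exact hG' {u, v, w} (SimpleGraph.is3Clique_triple_iff.2 h)
  have hcount : (#(G.cliqueFinset 3) : ℝ) ≤ _ := Nat.cast_le.2 (card_cliqueFinset_three_le G H hcover)
  -- For `b = 1` the power of `x` is `1`, not small, but its coefficient vanishes.
  have hbx : ((b : ℝ) - 1) * x ^ (a * (b - 1)) ≤ κ := by
    rcases Nat.lt_or_ge 1 b with hb2 | hb2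
    · have h1 : x ^ (a * (b - 1)) ≤ x :=
        pow_le_of_le_one hx0.le hx1.le (Nat.mul_ne_zero ha.ne' (by omega))
      calc ((b : ℝ) - 1) * x ^ (a * (b - 1)) ≤ b * x := by gcongr; linarith
        _ ≤ κ := by linarith
    · obtain rfl : b = 1 := by omega
      simpa using hκ0.le
  have hax : ((a : ℝ) - 1) * (Fintype.card V : ℝ) ^ 2 ≤ ε / 2 * (Fintype.card V : ℝ) ^ 3 * x := by
    rcases Nat.lt_or_ge 1 a with ha2 | ha2
    · have h1 : x ^ (a * b) ≤ x * x := by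
        rw [← sq]
        exact pow_le_pow_of_le_one hx0.le hx1.le (by nlinarith)
      calc ((a : ℝ) - 1) * (Fintype.card V : ℝ) ^ 2 ≤ a * (Fintype.card V : ℝ) ^ 2 := by
            gcongr; linarith
        _ = a * (Fintype.card V : ℝ) ^ 3 * x ^ (a * b) := by
            linear_combination (-(a * (Fintype.card V : ℝ) ^ 2)) * hxn
        _ ≤ a * (Fintype.card V : ℝ) ^ 3 * (x * x) := by gcongr
        _ = (x * a) * ((Fintype.card V : ℝ) ^ 3 * x) := by ring
        _ ≤ ε / 2 * ((Fintype.card V : ℝ) ^ 3 * x) := by gcongr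
        _ = _ := by ring
    · obtain rfl : a = 1 := by omega
      simp only [Nat.cast_one, sub_self, zero_mul]
      positivity
  have hmain := card_triangles_through_subgraph_le G H (hH ▸ sdiff_le) ha hb hc hfree (t := ε / 2)
    hx0.le hxn (by positivity) hdeg (by
      have hf : (0 : ℝ) < a ! := by positivity
      calc (a ! : ℝ) * ((b - 1) * x ^ (a * (b - 1)) + c * η) ≤ a ! * (κ + c * η) := by gcongr
        _ = (ε / 2) ^ a := by
          rw [hη, hκ]; field_simp; ring)
  push_cast at hcount
  linarith [hcount.trans hmain]

end TriangleCounting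

/-! ### Induction on the number of parts through common links. -/

section CliqueInduction

open Finset
open scoped Classical Nat

variable {V : Type*}

/-- `G` contains a complete multipartite graph with parts of sizes `s i`. -/
def SimpleGraph.HasMultipartite (G : SimpleGraph V) {r : ℕ} (s : Fin r → ℕ) : Prop :=
  ∃ A : Fin r → Finset V, (∀ i, #(A i) = s i) ∧
    ∀ i j, i ≠ j → ∀ x ∈ A i, ∀ y ∈ A j, G.Adj x y

theorem SimpleGraph.HasMultipartite.isContained {G : SimpleGraph V} {r : ℕ} {s : Fin r → ℕ}
    (h : G.HasMultipartite s) :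
    (SimpleGraph.completeMultipartiteGraph fun i : Fin r => Fin (s i)).IsContained G := by
  obtain ⟨A, hcard, hadj⟩ := h
  let e : ∀ i, Fin (s i) ≃ A i := fun i => ((A i).equivFinOfCardEq (hcard i)).symm
  refine ⟨⟨⟨fun p => (e p.1 p.2 : V), ?_⟩, ?_⟩⟩
  · intro p q hpq
    exact hadj p.1 q.1 hpq _ (e p.1 p.2).2 _ (e q.1 q.2).2
  · rintro ⟨i, p⟩ ⟨j, q⟩ hpq
    change (e i p : V) = e j q at hpq
    by_cases hij : i = j
    · subst hij
      rw [(e i).injective (Subtype.ext hpq)]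
    · have := hadj i j hij _ (e i p).2 _ (e j q).2
      rw [hpq] at this
      exact absurd this (G.loopless.irrefl _)

/-- The edges of `G` between common neighbours of the vertices of `S`. -/
def SimpleGraph.commonLink (G : SimpleGraph V) (S : Finset V) : SimpleGraph V where
  Adj x y := G.Adj x y ∧ ∀ v ∈ S, G.Adj v x ∧ G.Adj v y
  symm := ⟨fun _ _ h => ⟨h.1.symm, fun v hv => (h.2 v hv).symm⟩⟩
  loopless := ⟨fun _ h => G.loopless.irrefl _ h.1⟩

/-- A vertex is known to be joined to `S` only through a link edge at it. The tail has at least two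
parts, all nonempty, so every vertex in it has such an edge. -/
theorem SimpleGraph.HasMultipartite.of_commonLink {G : SimpleGraph V} {r : ℕ}
    {s : Fin (r + 3) → ℕ} (hs : ∀ i, 0 < s i) {S : Finset V} (hS : #S = s 0)
    (h : (G.commonLink S).HasMultipartite (Fin.tail s)) : G.HasMultipartite s := by
  obtain ⟨A, hcard, hadj⟩ := h
  have hlink : ∀ i, ∀ y ∈ A i, ∀ v ∈ S, G.Adj v y := by
    intro i y hy v hv
    obtain ⟨j, hj⟩ := exists_ne i
    have hpos : 0 < #(A j) := by rw [hcard]; exact hs _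
    obtain ⟨z, hz⟩ := Finset.card_pos.1 hpos
    exact ((hadj i j hj.symm y hy z hz).2 v hv).1
  refine ⟨Fin.cons S A, ?_, ?_⟩
  · refine Fin.cases ?_ fun i => ?_
    · simpa using hS
    · simpa [Fin.tail] using hcard i
  · refine Fin.cases (Fin.cases ?_ fun j => ?_) fun i => Fin.cases ?_ fun j => ?_
    · exact fun h => absurd rfl h
    · intro _ x hx y hy
      exact hlink j y (by simpa using hy) x (by simpa using hx)
    · intro _ x hx y hy
      exact (hlink i x (by simpa using hx) y (by simpa using hy)).symm
    · intro hij x hx y hy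
      exact (hadj i j (fun h => hij (by rw [h])) x (by simpa using hx) y (by simpa using hy)).1

variable [Fintype V]

theorem card_cliqueFinset_succ_le_sum (G : SimpleGraph V) (r : ℕ) :
    #(G.cliqueFinset (r + 1)) ≤ ∑ e ∈ G.cliqueFinset r, #{v | ∀ u ∈ e, G.Adj v u} := by
  rw [← Finset.card_sigma]
  refine (Finset.card_le_card ?_).trans
    (Finset.card_image_le (f := fun q : Σ _ : Finset V, V => insert q.2 q.1))
  intro t ht
  rw [SimpleGraph.mem_cliqueFinset_iff, SimpleGraph.isNClique_iff] at ht
  obtain ⟨v, hv⟩ := Finset.card_pos.1 (by omega : 0 < #t)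
  simp only [Finset.mem_image, Finset.mem_sigma, Finset.mem_filter, Finset.mem_univ, true_and,
    SimpleGraph.mem_cliqueFinset_iff, SimpleGraph.isNClique_iff]
  refine ⟨⟨t.erase v, v⟩, ⟨⟨?_, ?_⟩, ?_⟩, Finset.insert_erase hv⟩
  · exact ht.1.subset (by simp)
  · rw [Finset.card_erase_of_mem hv, ht.2]; rfl
  · intro u hu
    exact ht.1 hv (Finset.mem_of_mem_erase hu) (Finset.ne_of_mem_erase hu).symm

/-- An `r`-clique completely joined to `S` is a clique of the common link of `S`. Convexity over
`k`-sets takes a `k`-th root, turning `x ^ k` into `x`. -/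
theorem card_cliqueFinset_succ_le (G : SimpleGraph V) {r k : ℕ} (hk : 0 < k) {x D t : ℝ}
    (hx : 0 ≤ x) (hD : 0 ≤ D) (ht : 0 ≤ t)
    (hlink : ∀ S : Finset V, #S = k →
      (#((G.commonLink S).cliqueFinset r) : ℝ) ≤ D * (Fintype.card V : ℝ) ^ r * x ^ k)
    (hbound : k ! * D ≤ t ^ k) :
    (#(G.cliqueFinset (r + 1)) : ℝ)
      ≤ (k - 1) * (Fintype.card V : ℝ) ^ r + t * (Fintype.card V : ℝ) ^ (r + 1) * x := by
  set n : ℝ := (Fintype.card V : ℝ) with hn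
  have h0 : (#(G.cliqueFinset (r + 1)) : ℝ) ≤ _ := Nat.cast_le.2 (card_cliqueFinset_succ_le_sum G r)
  push_cast at h0
  refine h0.trans ?_
  refine sum_card_filter_le_of_card_common_le (G.cliqueFinset r) univ
    (fun v (e : Finset V) => ∀ u ∈ e, G.Adj v u) hk (M := n ^ r) (τ := t * n ^ (r + 1) * x)
    ?_ (by positivity) (fun _ => D * n ^ r * x ^ k) ?_ ?_
  · rw [hn]
    exact_mod_cast G.card_cliqueFinset_le.trans (Nat.choose_le_pow _ _)
  · intro S hS
    refine le_trans (Nat.cast_le.2 (Finset.card_le_card ?_)) (hlink S (Finset.mem_powersetCard.1 hS).2)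
    intro e he
    simp only [Finset.mem_filter, SimpleGraph.mem_cliqueFinset_iff,
      SimpleGraph.isNClique_iff] at he ⊢
    refine ⟨fun u hu w hw huw => ⟨he.1.1 hu hw huw, fun v hv => ?_⟩, he.1.2⟩
    exact ⟨he.2 v hv u hu, he.2 v hv w hw⟩
  · rw [Finset.sum_const, Finset.card_powersetCard, Finset.card_univ, nsmul_eq_mul]
    obtain ⟨l, rfl⟩ : ∃ l, k = l + 1 := ⟨k - 1, by omega⟩
    have hch : ((Fintype.card V).choose (l + 1) : ℝ) ≤ n ^ (l + 1) := by
      rw [hn]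
      exact_mod_cast Nat.choose_le_pow _ _
    rw [Nat.add_sub_cancel]
    calc (n ^ r) ^ l * ((l + 1)! * ((Fintype.card V).choose (l + 1) * (D * n ^ r * x ^ (l + 1))))
        ≤ (n ^ r) ^ l * ((l + 1)! * (n ^ (l + 1) * (D * n ^ r * x ^ (l + 1)))) := by gcongr
      _ = ((l + 1)! * D) * (n ^ (r + 1) * x) ^ (l + 1) := by ring
      _ ≤ t ^ (l + 1) * (n ^ (r + 1) * x) ^ (l + 1) := by gcongr
      _ = (t * n ^ (r + 1) * x) ^ (l + 1) := by ring

/-- The `o(n ^ (r - 1 / ∏ s i))` bound, with `x` standing for `n ^ (-1 / ∏ s i)`. -/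
theorem exists_card_cliqueFinset_le (m : ℕ) (s : Fin (m + 3) → ℕ) (hs : ∀ i, 0 < s i)
    {ε : ℝ} (hε : 0 < ε) :
    ∃ δ > 0, ∀ (V : Type) [Fintype V] (G : SimpleGraph V) (x : ℝ), 0 < x → x < δ →
      x ^ (∏ i : Fin (m + 2), s i.castSucc) * Fintype.card V = 1 → ¬ G.HasMultipartite s →
      (#(G.cliqueFinset (m + 3)) : ℝ) ≤ ε * (Fintype.card V : ℝ) ^ (m + 3) * x := by
  induction m generalizing ε with
  | zero =>
    obtain ⟨δ, hδ, h⟩ := exists_card_triangles_le_of_free (hs 0) (hs 1) (hs 2) hε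
    refine ⟨δ, hδ, fun V _ G x hx hxδ hxn hG => ?_⟩
    refine h V G x hx hxδ (by simpa [Fin.prod_univ_two] using hxn) ?_
    intro S T Q hS hT hST hSQ hTQ
    by_contra! hQ
    obtain ⟨Q', hQ'Q, hQ'⟩ := Finset.exists_subset_card_eq hQ.le
    refine hG ⟨![S, T, Q'], ?_, ?_⟩
    · intro i
      fin_cases i
      exacts [hS, hT, hQ']
    · intro i j hij u hu v hv
      fin_cases i <;> fin_cases j
      · exact absurd rfl hij
      · exact hST u hu v hv
      · exact hSQ u hu v (hQ'Q hv)
      · exact (hST v hv u hu).symm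
      · exact absurd rfl hij
      · exact hTQ u hu v (hQ'Q hv)
      · exact (hSQ v hv u (hQ'Q hu)).symm
      · exact (hTQ v hv u (hQ'Q hu)).symm
      · exact absurd rfl hij
  | succ m ih =>
    set k := s 0 with hk
    have hk0 : 0 < k := hs 0
    have hkpos : (0 : ℝ) < k := by exact_mod_cast hk0
    set D : ℝ := (ε / 2) ^ k / k ! with hD
    have hD0 : 0 < D := by positivity
    obtain ⟨δ, hδ, h⟩ := ih (Fin.tail s) (fun i => hs _) hD0
    refine ⟨min (min 1 δ) (ε / 2 / k), by positivity, fun V _ G x hx hxδ hxn hG => ?_⟩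
    simp only [lt_min_iff] at hxδ
    obtain ⟨⟨hx1, hxδ⟩, hxε⟩ := hxδ
    rw [lt_div_iff₀ hkpos] at hxε
    rw [Fin.prod_univ_succ] at hxn
    set P' : ℕ := ∏ i : Fin (m + 2), s i.succ.castSucc with hP'
    have hP'0 : 0 < P' := Finset.prod_pos fun i _ => hs _
    change x ^ (k * P') * _ = 1 at hxn
    -- In the link, `x ^ k` plays the role of `x`: `(x ^ k) ^ P' * n = 1` and `x ^ k ≤ x < δ`.
    have hmain := card_cliqueFinset_succ_le (V := V) G (r := m + 3) hk0 (t := ε / 2) hx.le hD0.le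
      (by positivity)
      (fun S hS => h V (G.commonLink S) (x ^ k) (by positivity)
        ((pow_le_of_le_one hx.le hx1.le hk0.ne').trans_lt hxδ)
        (by rw [← pow_mul]; exact hxn)
        (fun hH => hG (hH.of_commonLink hs hS)))
      (by rw [hD]; exact le_of_eq (by field_simp))
    have hkx : ((k : ℝ) - 1) * (Fintype.card V : ℝ) ^ (m + 3)
        ≤ ε / 2 * (Fintype.card V : ℝ) ^ (m + 4) * x := by
      rcases Nat.lt_or_ge 1 k with hk2 | hk2
      · have h1 : x ^ (k * P') ≤ x * x := by
          rw [← sq]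
          exact pow_le_pow_of_le_one hx.le hx1.le (by nlinarith)
        calc ((k : ℝ) - 1) * (Fintype.card V : ℝ) ^ (m + 3)
            ≤ k * (Fintype.card V : ℝ) ^ (m + 3) := by gcongr; linarith
          _ = k * (Fintype.card V : ℝ) ^ (m + 4) * x ^ (k * P') := by
              linear_combination (-(k * (Fintype.card V : ℝ) ^ (m + 3))) * hxn
          _ ≤ k * (Fintype.card V : ℝ) ^ (m + 4) * (x * x) := by gcongr
          _ = (x * k) * ((Fintype.card V : ℝ) ^ (m + 4) * x) := by ring
          _ ≤ ε / 2 * ((Fintype.card V : ℝ) ^ (m + 4) * x) := by gcongr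
          _ = _ := by ring
      · have hk1 : k = 1 := by omega
        rw [hk1]
        simp only [Nat.cast_one, sub_self, zero_mul]
        positivity
    have e : m + 1 + 3 = m + 3 + 1 := by ring
    rw [e]
    linarith

/-- A copy of a complete graph is determined by its vertex set. -/
theorem copyCount_completeGraph_le (G : SimpleGraph V) (r : ℕ) :
    G.copyCount (⊤ : SimpleGraph (Fin r)) ≤ #(G.cliqueFinset r) := by
  rw [SimpleGraph.copyCount_eq_card_image_copyToSubgraph]
  refine Finset.card_le_card_of_injOn (fun G' => G'.verts.toFinset) ?_ ?_
  · intro G' hG'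
    simp only [Finset.coe_image, Set.mem_image] at hG'
    obtain ⟨f, -, rfl⟩ := hG'
    simp only [Finset.mem_coe, SimpleGraph.mem_cliqueFinset_iff, SimpleGraph.isNClique_iff]
    refine ⟨?_, ?_⟩
    · intro u hu v hv huv
      simp at hu hv
      obtain ⟨i, rfl⟩ := hu
      obtain ⟨j, rfl⟩ := hv
      exact f.toHom.map_adj (show (⊤ : SimpleGraph (Fin r)).Adj i j from fun h => huv (by rw [h]))
    · have : (f.toSubgraph.verts.toFinset : Finset V) = univ.image f := by
        ext; simp
      rw [this, Finset.card_image_of_injective univ (f := f) f.injective, Finset.card_univ,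
        Fintype.card_fin]
  · have key : ∀ f : SimpleGraph.Copy (⊤ : SimpleGraph (Fin r)) G, ∀ u v,
        f.toSubgraph.Adj u v ↔ u ≠ v ∧ u ∈ f.toSubgraph.verts ∧ v ∈ f.toSubgraph.verts := by
      intro f u v
      refine ⟨fun h => ⟨h.ne, h.fst_mem, h.snd_mem⟩, ?_⟩
      rintro ⟨huv, hu, hv⟩
      simp at hu hv
      obtain ⟨i, rfl⟩ := hu
      obtain ⟨j, rfl⟩ := hv
      exact ⟨i, j, fun h => huv (by rw [h]), rfl, rfl⟩
    intro G₁ h₁ G₂ h₂ h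
    simp only [Finset.coe_image, Set.mem_image] at h₁ h₂
    obtain ⟨f, -, rfl⟩ := h₁
    obtain ⟨g, -, rfl⟩ := h₂
    have hv : f.toSubgraph.verts = g.toSubgraph.verts := Set.toFinset_inj.1 h
    refine SimpleGraph.Subgraph.ext hv ?_
    ext u v
    rw [key, key, hv]

theorem generalizedTuranNumber_completeGraph_le {W : Type*} (H : SimpleGraph W) (n r : ℕ) {C : ℝ}
    (hC : 0 ≤ C)
    (h : ∀ G : SimpleGraph (Fin n), H.Free G → (#(G.cliqueFinset r) : ℝ) ≤ C) :
    (generalizedTuranNumber n (⊤ : SimpleGraph (Fin r)) H : ℝ) ≤ C := by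
  refine le_trans (Nat.cast_le.2 ?_) (Nat.floor_le hC)
  rw [generalizedTuranNumber]
  refine Finset.sup_le fun G hG => Nat.le_floor ?_
  have hcopy : G.copyCount (⊤ : SimpleGraph (Fin r)) ≤ #(G.cliqueFinset r) := by
    convert copyCount_completeGraph_le G r
  exact (Nat.cast_le.2 hcopy).trans (h G (Finset.mem_filter.1 hG).2)

end CliqueInduction

/-! ### Passage to the asymptotic statement. -/

theorem theorem1 (r : ℕ) (hr : 3 ≤ r) (s : Fin r → ℕ) (hpos : ∀ i, 0 < s i) (hs : Monotone s) :
    (fun n : ℕ =>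
      (generalizedTuranNumber n (⊤ : SimpleGraph (Fin r))
        (SimpleGraph.completeMultipartiteGraph fun i : Fin r => Fin (s i)) : ℝ))
    =o[Filter.atTop]
    (fun n : ℕ =>
      (n : ℝ) ^ ((r : ℝ) - 1 / ∏ i ∈ Finset.univ.filter (fun i : Fin r => (i : ℕ) + 1 < r), (s i : ℝ))) := by
  obtain ⟨m, rfl⟩ : ∃ m, r = m + 3 := ⟨r - 3, by omega⟩
  set P : ℕ := ∏ i : Fin (m + 2), s i.castSucc with hP
  have hP0 : 0 < P := Finset.prod_pos fun i _ => hpos _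
  have hPr : (0 : ℝ) < P := by exact_mod_cast hP0
  have hprod : ∏ i ∈ Finset.univ.filter (fun i : Fin (m + 3) => (i : ℕ) + 1 < m + 3), (s i : ℝ)
      = P := by
    rw [Finset.prod_filter, Fin.prod_univ_castSucc, hP]
    simp
  rw [hprod, Asymptotics.isLittleO_iff]
  intro ε hε
  obtain ⟨δ, hδ, h⟩ := exists_card_cliqueFinset_le m s hpos hε
  have hlim : Filter.Tendsto (fun n : ℕ => (n : ℝ) ^ (-(1 / (P : ℝ)))) Filter.atTop (nhds 0) :=
    (tendsto_rpow_neg_atTop (by positivity)).comp tendsto_natCast_atTop_atTop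
  filter_upwards [hlim.eventually_lt_const hδ, Filter.eventually_gt_atTop 0] with n hnδ hn
  have hn' : (0 : ℝ) < n := by exact_mod_cast hn
  have hxn : ((n : ℝ) ^ (-(1 / (P : ℝ)))) ^ P * n = 1 := by
    rw [← Real.rpow_natCast, ← Real.rpow_mul hn'.le, neg_mul, one_div, inv_mul_cancel₀ hPr.ne',
      Real.rpow_neg_one, inv_mul_cancel₀ hn'.ne']
  have hsplit : (n : ℝ) ^ (((m + 3 : ℕ) : ℝ) - 1 / P)
      = (n : ℝ) ^ (m + 3) * (n : ℝ) ^ (-(1 / (P : ℝ))) := by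
    rw [sub_eq_add_neg, Real.rpow_add hn', Real.rpow_natCast]
  rw [Real.norm_of_nonneg (by positivity), Real.norm_of_nonneg (by positivity), hsplit]
  refine generalizedTuranNumber_completeGraph_le _ _ _ (by positivity) fun G hG => ?_
  have := h (Fin n) G _ (by positivity) hnδ (by rw [Fintype.card_fin]; exact hxn)
    (fun hH => hG hH.isContained)
  rw [Fintype.card_fin, mul_assoc] at this
  convert this
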